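/- Let $\Gamma$ be a finite simplicial graph whose edges are labelled by integers $\ge 2$, and let $G = G_\Gamma$ be the associated Artin group: its generators are the vertices of $\Gamma$, and for every edge with end points $u,v$ and label $n$ there is the relation $$\underbrace{uvu\cdots}_{n \text{ factors}}=\underbrace{vuv\cdots}_{n \text{ factors}}.$$ Assume that $G$ is an even Artin group (all labels are even) and that every closed reduced path (cycle without repeated vertices) in $\Gamma$ all of whose labels are bigger than $2$ has odd length. For a finitely generated group $H$ let $S(H)$ be the character sphere, i.e. the set of classes $[\mu]$ of non-zero homomorphisms $\mu : H \to \mathbb{R}$ up to multiplication by positive real numbers. The invariant $\Sigma^1(H) \subseteq S(H)$ is the set of all $[\mu]$ such that, in a Cayley graph of $H$ with respect to a finite generating set $X$ (with edges joining $h$ and $hx$ for $h \in H$, $x \in X$), the subgraph spanned by the vertices $h$ with $\mu(h) \ge 0$ is connected; this does not depend on the choice of $X$. Then for every $[\chi] \in S(G)$ we have $$[\chi] \in \Sigma^1(G) \iff [\overline{\chi}] \in \Sigma^1(G/G''),$$ where $G''$ is the second derived subgroup of $G$ and $\overline{\chi}$ is the real character of $G/G''$ induced by $\chi$. -/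

import Mathlib

/-- A simplicial graph on the vertex set `V` whose edges are labelled by integers `≥ 2`. -/
structure LabelledGraph (V : Type*) where
  /-- the underlying simplicial graph -/
  graph : SimpleGraph V
  /-- the label of each edge -/
  label : graph.edgeSet → ℕ
  two_le_label : ∀ e, 2 ≤ label e

/-- The alternating product `a * b * a * ⋯` with `n` factors. -/
def altProd {M : Type*} [Monoid M] : ℕ → M → M → M
  | 0, _, _ => 1
  | n + 1, a, b => a * altProd n b a

namespace LabelledGraph

variable {V : Type*} (Γ : LabelledGraph V)

/-- The defining relators `(u v u ⋯) (v u v ⋯)⁻¹` (with `n` factors each) of the Artin group,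
one for each edge with end points `u`, `v` and label `n` (in either orientation). -/
def artinRels : Set (FreeGroup V) :=
  {r | ∃ (u v : V) (h : Γ.graph.Adj u v),
    r = altProd (Γ.label ⟨s(u, v), h⟩) (FreeGroup.of u) (FreeGroup.of v) *
      (altProd (Γ.label ⟨s(u, v), h⟩) (FreeGroup.of v) (FreeGroup.of u))⁻¹}

/-- The Artin group `G_Γ`. -/
abbrev ArtinGroup : Type _ := PresentedGroup Γ.artinRels

/-- All labels are even, i.e. the Artin group of `Γ` is an even Artin group. -/
def IsEven : Prop := ∀ e, Even (Γ.label e)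

/-- Every closed reduced path of `Γ` (a cycle, of length at least 3 and without repeated
vertices) all of whose labels are bigger than 2 has odd length. -/
def OddCycleCondition : Prop :=
  ∀ (v : V) (c : Γ.graph.Walk v v), c.IsCycle →
    (∀ (e : Sym2 V) (he : e ∈ c.edges), 2 < Γ.label ⟨e, c.edges_subset_edgeSet he⟩) →
    Odd c.length

end LabelledGraph

/-- Real characters of a group `G`, i.e. homomorphisms from `G` to the additive group of `ℝ`.
They form a real vector space. -/
abbrev RealCharacter (G : Type*) [Group G] : Type _ := Additive G →+ ℝ

/-- The character sphere `S(G)`: nonzero real characters up to positive real multiples. -/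
abbrev CharacterSphere (G : Type*) [Group G] : Type _ := Module.Ray ℝ (RealCharacter G)

/-- The invariant `Σ¹(G)`: the classes `[χ]` such that, in the Cayley graph of `G` with respect to
a finite generating set `X` (edges join `g` and `g * x` for `x ∈ X`), the subgraph spanned by the
vertices `g` with `χ g ≥ 0` is connected. -/
def sigmaOne (G : Type*) [Group G] : Set (CharacterSphere G) :=
  {c | ∃ (χ : RealCharacter G) (hχ : χ ≠ 0), c = rayOfNeZero ℝ χ hχ ∧
    ∃ X : Set G, X.Finite ∧ Subgroup.closure X = ⊤ ∧
      ((SimpleGraph.mulCayley X).induce {g : G | 0 ≤ χ (Additive.ofMul g)}).Connected}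

namespace RealCharacter

variable {G : Type*} [Group G]

theorem derivedSeries_two_le_ker (χ : RealCharacter G) :
    derivedSeries G 2 ≤ (AddMonoidHom.toMultiplicativeRight χ).ker :=
  (derivedSeries_antitone G one_le_two).trans <| by
    rw [derivedSeries_one]
    exact Abelianization.commutator_subset_ker _

/-- The character `χ̄` of `G / G''` induced by a real character `χ` of `G`. -/
def metabelian (χ : RealCharacter G) : RealCharacter (G ⧸ derivedSeries G 2) :=
  MonoidHom.toAdditiveLeft
    (QuotientGroup.lift (derivedSeries G 2) (AddMonoidHom.toMultiplicativeRight χ)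
      χ.derivedSeries_two_le_ker)

theorem metabelian_mk (χ : RealCharacter G) (g : G) :
    χ.metabelian (Additive.ofMul (QuotientGroup.mk g)) = χ (Additive.ofMul g) := rfl

theorem metabelian_ne_zero {χ : RealCharacter G} (hχ : χ ≠ 0) : χ.metabelian ≠ 0 := by
  intro h
  refine hχ (AddMonoidHom.ext fun g => ?_)
  have := χ.metabelian_mk g.toMul
  rw [h] at this
  exact this.symm

end RealCharacter

/-! One direction is formal: the quotient map sends paths in a half-space to paths in a half-space.
For the converse both sides are compared with a condition on the graph: the living graph is
connected on the vertices of nonzero weight, and every vertex of weight zero has a neighbour of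
nonzero weight. If the condition holds, `mem_sigmaOne_of_livingGraph` puts `χ` in `Σ¹(G)`, because
commuting elements of positive character allow all paths to be pushed upwards and joined there. If
it fails, `G` acts by affine maps on a field of Hahn series, the linear parts having valuation `χ`.
Affine groups are metabelian, so the action factors through `G / G''`, where
`exists_not_halfSpaceJoined` excludes the induced character. When the living graph is disconnected,
one component fixes `0` and the other living vertices fix `1`; across a dead edge of label `2k` the
product of linear parts must be a nontrivial `k`-th root of unity. The dead edges in question form a
bipartite graph, so the odd cycle condition makes it a forest, and on a forest such phases can be
prescribed freely. -/

/-! ### Paths in half-spaces and passage to the metabelian quotient -/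

/-- `g` and `h` are joined by a path in the half-space `χ ≥ 0` of the Cayley graph. -/
def HalfSpaceJoined {G : Type*} [Group G] (X : Set G) (χ : RealCharacter G) (g h : G) : Prop :=
  ∃ (hg : 0 ≤ χ (Additive.ofMul g)) (hh : 0 ≤ χ (Additive.ofMul h)),
    ((SimpleGraph.mulCayley X).induce {g : G | 0 ≤ χ (Additive.ofMul g)}).Reachable
      ⟨g, hg⟩ ⟨h, hh⟩

namespace HalfSpaceJoined

variable {G : Type*} [Group G] {X : Set G} {χ : RealCharacter G} {g h k : G}

theorem refl (hg : 0 ≤ χ (Additive.ofMul g)) : HalfSpaceJoined X χ g g :=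
  ⟨hg, hg, SimpleGraph.Reachable.refl _⟩

theorem symm : HalfSpaceJoined X χ g h → HalfSpaceJoined X χ h g :=
  fun ⟨hg, hh, r⟩ => ⟨hh, hg, r.symm⟩

theorem trans : HalfSpaceJoined X χ g h → HalfSpaceJoined X χ h k → HalfSpaceJoined X χ g k :=
  fun ⟨hg, _, r⟩ ⟨_, hk, r'⟩ => ⟨hg, hk, r.trans r'⟩

theorem mul_right {x : G} (hx : x ∈ X) (hg : 0 ≤ χ (Additive.ofMul g))
    (hgx : 0 ≤ χ (Additive.ofMul (g * x))) : HalfSpaceJoined X χ g (g * x) := by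
  by_cases h1 : g = g * x
  · rw [← h1]; exact refl hg
  · refine ⟨hg, hgx, SimpleGraph.Adj.reachable ?_⟩
    rw [SimpleGraph.comap_adj]
    exact (SimpleGraph.mulCayley_adj' X _ _).2 ⟨h1, x, hx, Or.inl rfl⟩

/-- The step is an equivalence because a path may traverse an edge labelled `x` in either direction.
-/
theorem induction {P : G → Prop} (hgh : HalfSpaceJoined X χ g h) (hP : P g)
    (step : ∀ a, ∀ x ∈ X, 0 ≤ χ (Additive.ofMul a) → 0 ≤ χ (Additive.ofMul (a * x)) →
      (P a ↔ P (a * x))) : P h := by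
  obtain ⟨hg, hh, ⟨w⟩⟩ := hgh
  suffices H : ∀ (a b : {g : G | 0 ≤ χ (Additive.ofMul g)}),
      ((SimpleGraph.mulCayley X).induce {g : G | 0 ≤ χ (Additive.ofMul g)}).Walk a b →
      P a → P b from H _ _ w hP
  intro a b w
  induction w with
  | nil => exact id
  | @cons a b c hab _ ih =>
    intro ha
    refine ih ?_
    rw [SimpleGraph.comap_adj] at hab
    obtain ⟨-, x, hx, e | e⟩ := (SimpleGraph.mulCayley_adj' X _ _).1 hab
    · have e' : (a : G) * x = b := e
      rw [← e']
      exact (step a x hx a.2 (by rw [e']; exact b.2)).1 ha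
    · have e' : (a : G) = b * x := e
      rw [e'] at ha
      exact (step b x hx b.2 (by rw [← e']; exact a.2)).2 ha

end HalfSpaceJoined

theorem connected_halfSpace_iff {G : Type*} [Group G] {X : Set G} {χ : RealCharacter G} :
    ((SimpleGraph.mulCayley X).induce {g : G | 0 ≤ χ (Additive.ofMul g)}).Connected ↔
      ∀ g, 0 ≤ χ (Additive.ofMul g) → HalfSpaceJoined X χ 1 g := by
  have h1 : 0 ≤ χ (Additive.ofMul (1 : G)) := by simp
  constructor
  · exact fun h g hg => ⟨h1, hg, h.preconnected _ _⟩
  · intro h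
    have : Nonempty {g : G | 0 ≤ χ (Additive.ofMul g)} := ⟨⟨1, h1⟩⟩
    refine ⟨fun a b => ?_⟩
    obtain ⟨_, _, r⟩ := (h a a.2).symm.trans (h b b.2)
    exact r

theorem rayOfNeZero_mem_sigmaOne_iff {G : Type*} [Group G] {χ : RealCharacter G} (hχ : χ ≠ 0) :
    rayOfNeZero ℝ χ hχ ∈ sigmaOne G ↔ ∃ X : Set G, X.Finite ∧ Subgroup.closure X = ⊤ ∧
      ∀ g, 0 ≤ χ (Additive.ofMul g) → HalfSpaceJoined X χ 1 g := by
  simp only [← connected_halfSpace_iff]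
  constructor
  · rintro ⟨χ', hχ', e, X, hX, hX', hc⟩
    refine ⟨X, hX, hX', ?_⟩
    obtain ⟨r, hr, rfl⟩ := ((ray_eq_iff hχ hχ').1 e).exists_pos_left hχ hχ'
    have : {g : G | 0 ≤ χ (Additive.ofMul g)} = {g : G | 0 ≤ (r • χ) (Additive.ofMul g)} := by
      ext g
      simp [AddMonoidHom.smul_apply, hr]
    rw [this]
    exact hc
  · rintro ⟨X, hX, hX', hc⟩
    exact ⟨χ, hχ, rfl, X, hX, hX', hc⟩

theorem mem_sigmaOne_metabelian {G : Type*} [Group G] {χ : RealCharacter G} (hχ : χ ≠ 0)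
    (h : rayOfNeZero ℝ χ hχ ∈ sigmaOne G) :
    rayOfNeZero ℝ χ.metabelian (RealCharacter.metabelian_ne_zero hχ) ∈
      sigmaOne (G ⧸ derivedSeries G 2) := by
  rw [rayOfNeZero_mem_sigmaOne_iff] at h ⊢
  obtain ⟨X, hX, hX', hc⟩ := h
  let π := QuotientGroup.mk' (derivedSeries G 2)
  have hπ : Function.Surjective π := QuotientGroup.mk'_surjective _
  refine ⟨π '' X, hX.image _, ?_, fun q hq => ?_⟩
  · rw [← MonoidHom.map_closure, hX', Subgroup.map_top_of_surjective _ hπ]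
  · obtain ⟨g, rfl⟩ := hπ q
    refine (hc g hq).induction (P := fun g => HalfSpaceJoined (π '' X) χ.metabelian 1 (π g))
      (by rw [map_one]; exact HalfSpaceJoined.refl (by rw [ofMul_one, map_zero])) fun a x hx ha hax => ?_
    have key : HalfSpaceJoined (π '' X) χ.metabelian (π a) (π (a * x)) := by
      rw [map_mul]
      exact HalfSpaceJoined.mul_right (Set.mem_image_of_mem _ hx) ha hax
    exact ⟨fun h => h.trans key, fun h => h.trans key.symm⟩

/-! ### Ends of half-spaces -/

/-- The sequences `g * z ^ n` and `h * y ^ n` are eventually joined in the half-space `χ ≥ 0`. -/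
def EndJoined {G : Type*} [Group G] (X : Set G) (χ : RealCharacter G) (g z h y : G) : Prop :=
  ∃ N : ℕ, ∀ n ≥ N, HalfSpaceJoined X χ (g * z ^ n) (h * y ^ n)

section Ends

variable {G : Type*} [Group G] {X : Set G} {χ : RealCharacter G}

theorem EndJoined.symm {g z h y : G} (H : EndJoined X χ g z h y) : EndJoined X χ h y g z :=
  H.imp fun _ hN n hn => (hN n hn).symm

theorem EndJoined.trans {g z h y k x : G} (H : EndJoined X χ g z h y)
    (H' : EndJoined X χ h y k x) : EndJoined X χ g z k x := by
  obtain ⟨N, hN⟩ := H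
  obtain ⟨N', hN'⟩ := H'
  exact ⟨max N N', fun n hn => (hN n (le_of_max_le_left hn)).trans (hN' n (le_of_max_le_right hn))⟩

/-- A word for `w` descends only by a bounded amount, so its path stays in the half-space when it
starts high enough. -/
theorem exists_joined_mul_right (hX : Subgroup.closure X = ⊤) (w : G) :
    ∃ C : ℝ, 0 ≤ C ∧ ∀ g, C ≤ χ (Additive.ofMul g) → HalfSpaceJoined X χ g (g * w) := by
  have hw : w ∈ Subgroup.closure X := hX ▸ Subgroup.mem_top w
  induction hw using Subgroup.closure_induction with
  | mem x hx =>
    refine ⟨|χ (Additive.ofMul x)|, abs_nonneg _, fun g hg => ?_⟩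
    have := neg_abs_le (χ (Additive.ofMul x))
    have := abs_nonneg (χ (Additive.ofMul x))
    refine HalfSpaceJoined.mul_right hx (by linarith) ?_
    rw [ofMul_mul, map_add]
    linarith
  | one => exact ⟨0, le_rfl, fun g hg => by rw [mul_one]; exact HalfSpaceJoined.refl hg⟩
  | mul x y _ _ hx hy =>
    obtain ⟨C, hC, h⟩ := hx
    obtain ⟨C', hC', h'⟩ := hy
    refine ⟨C + C' + |χ (Additive.ofMul x)|, by positivity, fun g hg => ?_⟩
    have := neg_abs_le (χ (Additive.ofMul x))
    have := abs_nonneg (χ (Additive.ofMul x))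
    rw [← mul_assoc]
    refine (h g (by linarith)).trans (h' _ ?_)
    rw [ofMul_mul, map_add]
    linarith
  | inv x _ hx =>
    obtain ⟨C, hC, h⟩ := hx
    refine ⟨C + |χ (Additive.ofMul x)|, by positivity, fun g hg => ?_⟩
    have := le_abs_self (χ (Additive.ofMul x))
    have H := h (g * x⁻¹) (by rw [ofMul_mul, ofMul_inv, map_add, map_neg]; linarith)
    rw [inv_mul_cancel_right] at H
    exact H.symm

theorem exists_le_character_mul_pow (g : G) {z : G} (hz : 0 < χ (Additive.ofMul z)) (C : ℝ) :
    ∃ N : ℕ, ∀ n ≥ N, C ≤ χ (Additive.ofMul (g * z ^ n)) := by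
  obtain ⟨N, hN⟩ := exists_nat_ge ((C - χ (Additive.ofMul g)) / χ (Additive.ofMul z))
  refine ⟨N, fun n hn => ?_⟩
  have h2 : (C - χ (Additive.ofMul g)) / χ (Additive.ofMul z) ≤ n := hN.trans (by exact_mod_cast hn)
  rw [div_le_iff₀ hz] at h2
  rw [ofMul_mul, ofMul_pow, map_add, map_nsmul, nsmul_eq_mul]
  linarith

/-- Since `g * z ^ n * x = g * x * z ^ n`, a single path labelled `x`, started high up, joins the
two rays. -/
theorem endJoined_mul_of_commute (hX : Subgroup.closure X = ⊤) (g : G) {x z : G}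
    (hz : 0 < χ (Additive.ofMul z)) (hxz : Commute x z) : EndJoined X χ g z (g * x) z := by
  obtain ⟨C, -, hC⟩ := exists_joined_mul_right (χ := χ) hX x
  obtain ⟨N, hN⟩ := exists_le_character_mul_pow g hz C
  refine ⟨N, fun n hn => ?_⟩
  have := hC _ (hN n hn)
  rwa [mul_assoc, ← (hxz.pow_right n).eq, ← mul_assoc] at this

/-- Both rays are joined to the common corner `g * y ^ n * z ^ n`, along paths that essentially
ascend. -/
theorem endJoined_of_commute (hX : Subgroup.closure X = ⊤) (g : G) {y z : G}
    (hy : 0 < χ (Additive.ofMul y)) (hz : 0 < χ (Additive.ofMul z)) (hyz : Commute y z) :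
    EndJoined X χ g y g z := by
  have key : ∀ {y z : G}, 0 < χ (Additive.ofMul y) → 0 < χ (Additive.ofMul z) →
      ∃ N : ℕ, ∀ n ≥ N, ∀ j : ℕ,
        HalfSpaceJoined X χ (g * y ^ n) (g * y ^ n * z ^ j) := by
    intro y z hy hz
    obtain ⟨C, hC0, hC⟩ := exists_joined_mul_right (χ := χ) hX z
    obtain ⟨N, hN⟩ := exists_le_character_mul_pow g hy C
    refine ⟨N, fun n hn j => ?_⟩
    induction j with
    | zero => simpa using HalfSpaceJoined.refl (hC0.trans (hN n hn))
    | succ j ih =>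
      rw [pow_succ, ← mul_assoc]
      refine ih.trans (hC _ ?_)
      rw [ofMul_mul (g * y ^ n), map_add, ofMul_pow, map_nsmul, nsmul_eq_mul]
      have := hN n hn
      have : 0 ≤ j * χ (Additive.ofMul z) := by positivity
      linarith
  obtain ⟨N, hN⟩ := key hy hz
  obtain ⟨N', hN'⟩ := key hz hy
  refine ⟨max N N', fun n hn => (hN n (le_of_max_le_left hn) n).trans ?_⟩
  have := (hN' n (le_of_max_le_right hn) n).symm
  rwa [mul_assoc, ← (hyz.pow_pow n n).eq, ← mul_assoc] at this

end Ends

/-! ### Characters whose living subgraph is connected and dominating -/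

theorem altProd_two_mul {M : Type*} [Monoid M] (k : ℕ) (a b : M) :
    altProd (2 * k) a b = (a * b) ^ k := by
  induction k with
  | zero => simp [altProd]
  | succ k ih =>
    rw [show 2 * (k + 1) = 2 * k + 1 + 1 by ring, altProd, altProd, ih, pow_succ', mul_assoc]

theorem map_altProd {M N : Type*} [Monoid M] [Monoid N] (f : M →* N) (n : ℕ) (a b : M) :
    f (altProd n a b) = altProd n (f a) (f b) := by
  induction n generalizing a b with
  | zero => simp [altProd]
  | succ n ih => rw [altProd, altProd, map_mul, ih]

/-- `a` conjugates `b * a` to `a * b`, hence also their `k`-th powers, which coincide. -/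
theorem commute_mul_pow {H : Type*} [Group H] {a b : H} {k : ℕ}
    (h : (a * b) ^ k = (b * a) ^ k) : Commute a ((a * b) ^ k) := by
  have h1 : SemiconjBy a (b * a) (a * b) := by simp [SemiconjBy, mul_assoc]
  have h2 := (h1.pow_right k).eq
  rw [← h] at h2
  exact h2

/-- The one of `g` and `g⁻¹` at which `χ` is positive, if `χ g ≠ 0`. -/
noncomputable def RealCharacter.positive {G : Type*} [Group G] (χ : RealCharacter G) (g : G) : G :=
  open Classical in if 0 < χ (Additive.ofMul g) then g else g⁻¹

namespace RealCharacter

variable {G : Type*} [Group G] (χ : RealCharacter G)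

theorem positive_eq_or (g : G) : χ.positive g = g ∨ χ.positive g = g⁻¹ := by
  unfold positive
  split_ifs <;> simp

theorem positive_pos {g : G} (hg : χ (Additive.ofMul g) ≠ 0) :
    0 < χ (Additive.ofMul (χ.positive g)) := by
  unfold positive
  split_ifs with h
  · exact h
  · rw [ofMul_inv, map_neg]
    have := lt_of_le_of_ne (not_lt.1 h) hg
    linarith

theorem commute_positive {g h : G} (hgh : Commute g h) : Commute g (χ.positive h) := by
  rcases χ.positive_eq_or h with e | e <;> rw [e]
  · exact hgh
  · exact hgh.inv_right

theorem positive_commute_positive {g h : G} (hgh : Commute g h) :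
    Commute (χ.positive g) (χ.positive h) :=
  (χ.commute_positive (χ.commute_positive hgh).symm).symm

end RealCharacter

theorem HalfSpaceJoined.mul_positive {G : Type*} [Group G] {X : Set G} {χ : RealCharacter G}
    {g x : G} (hx : x ∈ X) (hg : 0 ≤ χ (Additive.ofMul g))
    (hgx : 0 ≤ χ (Additive.ofMul (g * χ.positive x))) :
    HalfSpaceJoined X χ g (g * χ.positive x) := by
  rcases χ.positive_eq_or x with e | e
  · rw [e] at hgx ⊢
    exact HalfSpaceJoined.mul_right hx hg hgx
  · rw [e] at hgx ⊢
    have := HalfSpaceJoined.mul_right hx hgx (by rwa [inv_mul_cancel_right])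
    rw [inv_mul_cancel_right] at this
    exact this.symm

namespace LabelledGraph

variable {V : Type*} {Γ : LabelledGraph V}

/-- The value of a real character of the Artin group at a standard generator. -/
def weight (χ : RealCharacter Γ.ArtinGroup) (v : V) : ℝ :=
  χ (Additive.ofMul (PresentedGroup.of v))

/-- The living subgraph of `Γ` with respect to `χ`. -/
def livingGraph (χ : RealCharacter Γ.ArtinGroup) : SimpleGraph V where
  Adj u v := weight χ u ≠ 0 ∧ weight χ v ≠ 0 ∧
    ∃ e : Γ.graph.edgeSet, e.1 = s(u, v) ∧ (Γ.label e = 2 ∨ weight χ u + weight χ v ≠ 0)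
  symm := ⟨fun u v ⟨hu, hv, e, he, h⟩ =>
    ⟨hv, hu, e, he.trans Sym2.eq_swap, h.imp_right (by rw [add_comm]; exact id)⟩⟩
  loopless := ⟨fun u ⟨_, _, e, he, _⟩ =>
    Γ.graph.loopless.irrefl u (Γ.graph.mem_edgeSet.1 (he ▸ e.2))⟩

theorem of_mul_of_pow {u v : V} {e : Γ.graph.edgeSet} (he : e.1 = s(u, v)) {k : ℕ}
    (hk : Γ.label e = 2 * k) :
    (PresentedGroup.of u * PresentedGroup.of v : Γ.ArtinGroup) ^ k =
      (PresentedGroup.of v * PresentedGroup.of u) ^ k := by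
  obtain ⟨e, hmem⟩ := e
  obtain rfl : e = s(u, v) := he
  have := PresentedGroup.mk_eq_mk_of_mul_inv_mem (rels := Γ.artinRels)
    (x := altProd (Γ.label ⟨s(u, v), hmem⟩) (FreeGroup.of u) (FreeGroup.of v))
    (y := altProd (Γ.label ⟨s(u, v), hmem⟩) (FreeGroup.of v) (FreeGroup.of u))
    ⟨u, v, hmem, rfl⟩
  rw [map_altProd, map_altProd, hk, altProd_two_mul, altProd_two_mul] at this
  exact this

theorem IsEven.exists_label_eq (hEven : Γ.IsEven) (e : Γ.graph.edgeSet) :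
    ∃ k, 1 ≤ k ∧ Γ.label e = 2 * k := by
  obtain ⟨k, hk⟩ := hEven e
  have := Γ.two_le_label e
  exact ⟨k, by omega, by omega⟩

section Sufficient

variable {χ : RealCharacter Γ.ArtinGroup}

/-- The subgroup generated by two adjacent vertices has a central element on which `χ` is positive
as soon as the weights of the vertices do not cancel. -/
theorem exists_pos_commute (hEven : Γ.IsEven) {u v : V} {e : Γ.graph.edgeSet} (he : e.1 = s(u, v))
    (h : weight χ u + weight χ v ≠ 0) :
    ∃ z : Γ.ArtinGroup, 0 < χ (Additive.ofMul z) ∧ Commute (PresentedGroup.of u) z ∧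
      Commute (PresentedGroup.of v) z := by
  obtain ⟨k, hk1, hk⟩ := hEven.exists_label_eq e
  have hrel := of_mul_of_pow he hk
  refine ⟨χ.positive ((PresentedGroup.of u * PresentedGroup.of v) ^ k), χ.positive_pos ?_,
    χ.commute_positive (commute_mul_pow hrel), χ.commute_positive ?_⟩
  · rw [ofMul_pow, ofMul_mul, map_nsmul, map_add, nsmul_eq_mul]
    exact mul_ne_zero (by positivity) h
  · rw [hrel]
    exact commute_mul_pow hrel.symm

theorem closure_range_of_eq_top :
    Subgroup.closure (Set.range (PresentedGroup.of : V → Γ.ArtinGroup)) = ⊤ :=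
  PresentedGroup.closure_range_of _

theorem endJoined_of_livingGraph_adj (hEven : Γ.IsEven) {u v : V}
    (huv : (livingGraph χ).Adj u v) (g : Γ.ArtinGroup) :
    EndJoined (Set.range PresentedGroup.of) χ g (χ.positive (PresentedGroup.of u))
      g (χ.positive (PresentedGroup.of v)) := by
  obtain ⟨hu, hv, e, he, h⟩ := huv
  by_cases hs : weight χ u + weight χ v = 0
  · have hl : Γ.label e = 2 * 1 := h.resolve_right (not_not_intro hs)
    have hrel := of_mul_of_pow he hl
    rw [pow_one, pow_one] at hrel
    exact endJoined_of_commute closure_range_of_eq_top g (χ.positive_pos hu) (χ.positive_pos hv)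
      (χ.positive_commute_positive hrel)
  · obtain ⟨z, hz, huz, hvz⟩ := exists_pos_commute hEven he hs
    exact (endJoined_of_commute closure_range_of_eq_top g (χ.positive_pos hu) hz
      (χ.commute_positive huz.symm).symm).trans
      (endJoined_of_commute closure_range_of_eq_top g hz (χ.positive_pos hv)
        (χ.commute_positive hvz.symm))

theorem endJoined_of_reachable (hEven : Γ.IsEven) {u v : V} (hu : weight χ u ≠ 0)
    (huv : (livingGraph χ).Reachable u v) (g : Γ.ArtinGroup) :
    EndJoined (Set.range PresentedGroup.of) χ g (χ.positive (PresentedGroup.of u))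
      g (χ.positive (PresentedGroup.of v)) := by
  obtain ⟨w⟩ := huv
  induction w with
  | nil =>
    exact endJoined_of_commute closure_range_of_eq_top g (χ.positive_pos hu) (χ.positive_pos hu)
      (Commute.refl _)
  | cons hab _ ih => exact (endJoined_of_livingGraph_adj hEven hab g).trans (ih hab.2.1)

theorem exists_weight_ne_zero (hχ : χ ≠ 0) : ∃ t, weight χ t ≠ 0 := by
  by_contra! H
  refine hχ (AddMonoidHom.toMultiplicativeRight.injective ?_)
  exact PresentedGroup.ext H

theorem mem_sigmaOne_of_livingGraph [Finite V] (hEven : Γ.IsEven) (hχ : χ ≠ 0)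
    (hconn : ∀ u v, weight χ u ≠ 0 → weight χ v ≠ 0 → (livingGraph χ).Reachable u v)
    (hdom : ∀ v, weight χ v = 0 → ∃ u, weight χ u ≠ 0 ∧ Γ.graph.Adj u v) :
    rayOfNeZero ℝ χ hχ ∈ sigmaOne Γ.ArtinGroup := by
  rw [rayOfNeZero_mem_sigmaOne_iff]
  refine ⟨Set.range PresentedGroup.of, Set.finite_range _, closure_range_of_eq_top, ?_⟩
  obtain ⟨t, ht⟩ := exists_weight_ne_zero hχ
  set T := χ.positive (PresentedGroup.of t : Γ.ArtinGroup) with hT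
  have hTpos : 0 < χ (Additive.ofMul T) := χ.positive_pos ht
  -- Switch from the ray of `T` to one whose direction commutes with `v`, cross the edge `v` there,
  -- and switch back. For `v` of weight zero the direction is the central element supplied by a
  -- living neighbour.
  have hgen : ∀ (v : V) (g : Γ.ArtinGroup),
      EndJoined (Set.range PresentedGroup.of) χ g T (g * PresentedGroup.of v) T := by
    intro v g
    by_cases hv : weight χ v = 0
    · obtain ⟨u, hu, huv⟩ := hdom v hv
      obtain ⟨z, hz, huz, hvz⟩ := exists_pos_commute (χ := χ) hEven (e := ⟨s(u, v), huv⟩) rfl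
        (by rwa [hv, add_zero])
      have key : ∀ g, EndJoined (Set.range PresentedGroup.of) χ g T g z := fun g =>
        (endJoined_of_reachable hEven ht (hconn t u ht hu) g).trans
          (endJoined_of_commute closure_range_of_eq_top g (χ.positive_pos hu) hz
            (χ.commute_positive huz.symm).symm)
      exact (key g).trans ((endJoined_mul_of_commute closure_range_of_eq_top g hz hvz).trans
        (key _).symm)
    · have key := endJoined_of_reachable hEven ht (hconn t v ht hv)
      exact (key g).trans ((endJoined_mul_of_commute closure_range_of_eq_top g (χ.positive_pos hv)
        (χ.commute_positive (Commute.refl _))).trans (key _).symm)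
  have hall : ∀ g : Γ.ArtinGroup, ∀ h,
      EndJoined (Set.range PresentedGroup.of) χ h T (h * g) T := by
    intro g
    have hg : g ∈ Subgroup.closure (Set.range (PresentedGroup.of : V → Γ.ArtinGroup)) :=
      closure_range_of_eq_top ▸ Subgroup.mem_top g
    induction hg using Subgroup.closure_induction with
    | mem x hx =>
      obtain ⟨v, rfl⟩ := hx
      exact hgen v
    | one =>
      intro h
      exact endJoined_mul_of_commute closure_range_of_eq_top h hTpos (Commute.one_left _)
    | mul x y _ _ hx hy =>
      intro h
      rw [← mul_assoc]
      exact (hx h).trans (hy _)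
    | inv x _ hx =>
      intro h
      have := (hx (h * x⁻¹)).symm
      rwa [inv_mul_cancel_right] at this
  -- The ray of `T` only ascends, so it connects `g` itself, not just high points, to its end.
  have hray : ∀ g : Γ.ArtinGroup, 0 ≤ χ (Additive.ofMul g) → ∀ n : ℕ,
      HalfSpaceJoined (Set.range PresentedGroup.of) χ g (g * T ^ n) := by
    intro g hg n
    have hpow : ∀ n : ℕ, 0 ≤ χ (Additive.ofMul (g * T ^ n)) := by
      intro n
      rw [ofMul_mul, map_add, ofMul_pow, map_nsmul, nsmul_eq_mul]
      positivity
    induction n with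
    | zero => simpa using HalfSpaceJoined.refl hg
    | succ n ih =>
      refine ih.trans ?_
      have hsucc := hpow (n + 1)
      rw [pow_succ, ← mul_assoc] at hsucc ⊢
      exact HalfSpaceJoined.mul_positive (Set.mem_range_self t) (hpow n) hsucc
  intro g hg
  obtain ⟨N, hN⟩ := hall g 1
  have := hN N le_rfl
  simp only [one_mul] at this
  have h1 := hray 1 (by simp) N
  rw [one_mul] at h1
  exact h1.trans (this.trans (hray g hg N).symm)

end Sufficient

end LabelledGraph

/-! ### Affine actions over valued fields as obstructions -/

/-- If the half-space were connected, the orbit of `0` under it would have valuation bounded below,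
since each edge changes `ρ g 0` by a term of bounded valuation. The elements `τ ^ n * s * τ ^ (-m)`,
with `τ` fixing `0` and `χ τ < 0`, violate this bound. -/
theorem exists_not_halfSpaceJoined {Q : Type*} [Group Q] {χ : RealCharacter Q} {K : Type*} [Field K]
    (v : AddValuation K (WithTop ℝ)) (ρ : Q →* Equiv.Perm K)
    (hρ : ∀ q x y, v (ρ q x - ρ q y) = (χ (Additive.ofMul q) : WithTop ℝ) + v (x - y))
    {t s : Q} (ht : ρ t 0 = 0) (htχ : χ (Additive.ofMul t) ≠ 0) (hs : ρ s 0 ≠ 0)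
    {X : Set Q} (hX : X.Finite) :
    ∃ g, 0 ≤ χ (Additive.ofMul g) ∧ ¬ HalfSpaceJoined X χ 1 g := by
  by_contra! H
  obtain ⟨C, hC⟩ : ∃ C : ℝ, ∀ x ∈ X, (C : WithTop ℝ) ≤ v (ρ x 0) := by
    have h1 : ∀ x : Q, ∃ C : ℝ, (C : WithTop ℝ) ≤ v (ρ x 0) := by
      intro x
      cases h : v (ρ x 0) with
      | top => exact ⟨0, le_top⟩
      | coe r => exact ⟨r, le_rfl⟩
    choose f hf using h1
    obtain ⟨C, hC⟩ := (hX.image f).bddBelow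
    exact ⟨C, fun x hx => (WithTop.coe_le_coe.2 (hC (Set.mem_image_of_mem f hx))).trans (hf x)⟩
  have hbound : ∀ g, 0 ≤ χ (Additive.ofMul g) → (C : WithTop ℝ) ≤ v (ρ g 0) := by
    intro g hg
    refine (H g hg).induction (P := fun g => (C : WithTop ℝ) ≤ v (ρ g 0)) (by simp) ?_
    intro a x hx ha _
    have hd : (C : WithTop ℝ) ≤ v (ρ (a * x) 0 - ρ a 0) := by
      have := hρ a (ρ x 0) 0
      rw [sub_zero] at this
      rw [map_mul, Equiv.Perm.mul_apply, this]
      calc (C : WithTop ℝ) ≤ v (ρ x 0) := hC x hx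
        _ = ((0 : ℝ) : WithTop ℝ) + v (ρ x 0) := by simp
        _ ≤ _ := by gcongr; exact_mod_cast ha
    constructor
    · intro h
      have := v.map_le_add hd h
      rwa [sub_add_cancel] at this
    · intro h
      have := v.map_le_sub h hd
      rwa [sub_sub_cancel] at this
  obtain ⟨τ, hτ, hτχ⟩ : ∃ τ, ρ τ 0 = 0 ∧ χ (Additive.ofMul τ) < 0 := by
    rcases htχ.lt_or_gt with h | h
    · exact ⟨t, ht, h⟩
    · refine ⟨t⁻¹, ?_, by simpa using h⟩
      rw [map_inv, Equiv.Perm.inv_eq_iff_eq, ht]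
  have hpow : ∀ n : ℕ, ρ (τ ^ n) 0 = 0 := by
    intro n
    induction n with
    | zero => simp
    | succ n ih => rw [pow_succ, map_mul, Equiv.Perm.mul_apply, hτ, ih]
  obtain ⟨r, hr⟩ : ∃ r : ℝ, v (ρ s 0) = r := by
    cases h : v (ρ s 0) with
    | top => exact absurd ((AddValuation.top_iff v).1 h) hs
    | coe r => exact ⟨r, rfl⟩
  -- `n` pushes the valuation below `C`; `m` then restores a nonnegative character without affecting
  -- the valuation.
  obtain ⟨n, hn⟩ := exists_nat_gt ((r - C) / -χ (Additive.ofMul τ))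
  obtain ⟨m, hm⟩ := exists_nat_ge
    (-(n * χ (Additive.ofMul τ) + χ (Additive.ofMul s)) / -χ (Additive.ofMul τ))
  rw [div_lt_iff₀ (by linarith)] at hn
  rw [div_le_iff₀ (by linarith)] at hm
  have h1 := hbound (τ ^ n * s * (τ ^ m)⁻¹) (by
    simp only [ofMul_mul, ofMul_inv, ofMul_pow, map_add, map_neg, map_nsmul, nsmul_eq_mul]
    linarith)
  have hm0 : ρ (τ ^ m)⁻¹ 0 = 0 := by rw [map_inv, Equiv.Perm.inv_eq_iff_eq, hpow]
  have h2 := hρ (τ ^ n) (ρ s 0) 0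
  rw [hpow, sub_zero, sub_zero, hr, ← WithTop.coe_add] at h2
  rw [map_mul, map_mul, Equiv.Perm.mul_apply, Equiv.Perm.mul_apply, hm0, h2, WithTop.coe_le_coe,
    ofMul_pow, map_nsmul, nsmul_eq_mul] at h1
  linarith

/-- The permutation `x ↦ a * x + b` of a field. -/
def affinePerm {K : Type*} [Field K] (a : Kˣ) (b : K) : Equiv.Perm K where
  toFun x := a * x + b
  invFun x := a⁻¹ * (x - b)
  left_inv x := by simp
  right_inv x := by simp

section Affine

variable {K : Type*} [Field K]

theorem affinePerm_apply (a : Kˣ) (b x : K) : affinePerm a b x = a * x + b := rfl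

theorem affinePerm_mul (a a' : Kˣ) (b b' : K) :
    affinePerm a b * affinePerm a' b' = affinePerm (a * a') (a * b' + b) := by
  ext x
  simp only [Equiv.Perm.mul_apply, affinePerm_apply, Units.val_mul]
  ring

/-- A map with linear part `a ≠ 1` has a fixed point and so is conjugate to scaling by `a`; `key`
expresses this with the denominator `a - 1` cleared. -/
theorem affinePerm_pow_eq_one {a : Kˣ} {k : ℕ} (h1 : a ≠ 1) (hk : a ^ k = 1) (b : K) :
    affinePerm a b ^ k = 1 := by
  have key : ∀ n : ℕ, ∀ x, ((a : K) - 1) * (affinePerm a b ^ n) x =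
      ((a : K) - 1) * a ^ n * x + (a ^ n - 1) * b := by
    intro n
    induction n with
    | zero => simp
    | succ n ih =>
      intro x
      rw [pow_succ, Equiv.Perm.mul_apply, ih, affinePerm_apply]
      ring
  ext x
  have h := key k x
  have hk' : (a : K) ^ k = 1 := by simpa using congrArg Units.val hk
  rw [hk', sub_self, zero_mul, add_zero, mul_one] at h
  exact mul_left_cancel₀ (sub_ne_zero.2 fun e => h1 (Units.ext e)) h

end Affine

/-- Commutators have linear part `1`, so `G'` acts by translations, and these commute. -/
theorem derivedSeries_two_le_ker_of_affine {G K : Type*} [Group G] [Field K]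
    (ρ : G →* Equiv.Perm K) (l : G →* Kˣ) (h : ∀ g x y, ρ g x - ρ g y = l g * (x - y)) :
    derivedSeries G 2 ≤ ρ.ker := by
  have htr : ∀ g ∈ derivedSeries G 1, ∀ x, ρ g x = x + ρ g 0 := by
    intro g hg x
    have hl : l g = 1 := by
      rw [derivedSeries_one] at hg
      exact Abelianization.commutator_subset_ker l hg
    have := h g x 0
    rw [hl, Units.val_one, one_mul, sub_zero] at this
    exact sub_eq_iff_eq_add.1 this
  rw [derivedSeries_succ, Subgroup.commutator_le]
  intro a ha b hb
  rw [MonoidHom.mem_ker, map_commutatorElement, commutatorElement_eq_one_iff_mul_comm]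
  ext x
  rw [Equiv.Perm.mul_apply, Equiv.Perm.mul_apply, htr a ha (ρ b x), htr b hb x, htr b hb (ρ a x),
    htr a ha x]
  ring

/-! ### Cochains on forests -/

theorem SimpleGraph.IsAcyclic.exists_potential {V : Type*} [Finite V] {M : Type*} [CommGroup M]
    {F : SimpleGraph V} (hF : F.IsAcyclic) (f : V → V → M) (hf : ∀ u v, f v u = (f u v)⁻¹) :
    ∃ w : V → M, ∀ u v, F.Adj u v → w u = f u v * w v := by
  classical
  induction hn : F.edgeSet.ncard generalizing F with
  | zero =>
    refine ⟨1, fun u v huv => ?_⟩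
    rw [Set.ncard_eq_zero] at hn
    exact absurd (F.mem_edgeSet.2 huv) (by simp [hn])
  | succ n ih =>
    obtain ⟨e, he⟩ : F.edgeSet.Nonempty := by
      rw [← Set.ncard_pos]; omega
    induction e using Sym2.ind with
    | _ a b =>
    have hbr := SimpleGraph.isAcyclic_iff_forall_adj_isBridge.1 hF he
    rw [SimpleGraph.isBridge_iff] at hbr
    obtain ⟨w, hw⟩ := ih (F := F.deleteEdges {s(a, b)}) (hF.anti (F.deleteEdges_le _)) (by
      rw [SimpleGraph.edgeSet_deleteEdges, Set.ncard_sdiff_singleton_of_mem he, hn]; rfl)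
    let F' := F.deleteEdges {s(a, b)}
    -- Removing the bridge separates `a` from `b`; rescaling the potential by `c` on the side of `a`
    -- fits the removed edge and preserves all the others.
    let c := f a b * w b * (w a)⁻¹
    refine ⟨fun x => if F'.Reachable a x then c * w x else w x, fun u v huv => ?_⟩
    by_cases h : s(u, v) = s(a, b)
    · rw [Sym2.eq_iff] at h
      have hbr' : ¬ F'.Reachable a b := hbr
      rcases h with ⟨rfl, rfl⟩ | ⟨rfl, rfl⟩
      · simp [c, hbr']
      · simp [c, hbr', hf v u]
    · have huv' : F'.Adj u v := by
        rw [SimpleGraph.deleteEdges_adj]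
        exact ⟨huv, h⟩
      have hiff : F'.Reachable a u ↔ F'.Reachable a v :=
        ⟨fun r => r.trans huv'.reachable, fun r => r.trans huv'.symm.reachable⟩
      simp only [hiff]
      split_ifs
      · rw [hw u v huv']
        exact mul_left_comm _ _ _
      · exact hw u v huv'

/-! ### Affine actions of even Artin groups -/

namespace LabelledGraph

variable {V : Type*} {Γ : LabelledGraph V}

section Representation

variable {G : Type*} [Group G]

theorem lift_eq_one_of_mem_artinRels {f : V → G}
    (h : ∀ (u v : V) (e : Γ.graph.edgeSet), e.1 = s(u, v) →
      altProd (Γ.label e) (f u) (f v) = altProd (Γ.label e) (f v) (f u)) :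
    ∀ r ∈ Γ.artinRels, FreeGroup.lift f r = 1 := by
  rintro r ⟨u, v, huv, rfl⟩
  rw [map_mul, map_inv, map_altProd, map_altProd, FreeGroup.lift_apply_of, FreeGroup.lift_apply_of,
    h u v ⟨s(u, v), huv⟩ rfl, mul_inv_cancel]

theorem ArtinGroup.induction {p : Γ.ArtinGroup → Prop} (of : ∀ v, p (PresentedGroup.of v))
    (one : p 1) (mul : ∀ g h, p g → p h → p (g * h)) (inv : ∀ g, p g → p g⁻¹)
    (g : Γ.ArtinGroup) : p g := by
  have hg : g ∈ Subgroup.closure (Set.range (PresentedGroup.of : V → Γ.ArtinGroup)) :=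
    closure_range_of_eq_top ▸ Subgroup.mem_top g
  induction hg using Subgroup.closure_induction with
  | mem x hx => obtain ⟨v, rfl⟩ := hx; exact of v
  | one => exact one
  | mul x y _ _ hx hy => exact mul x y hx hy
  | inv x _ hx => exact inv x hx

end Representation

/-- If the standard generators act on a valued field by affine maps `x ↦ a x + b` such that the
valuation of `a` is the value of `χ`, one of them having a fixed point which is not common to all
of them, then the character induced by `χ` is not in `Σ¹` of the maximal metabelian quotient. -/
theorem metabelian_notMem_sigmaOne_of_affine {χ : RealCharacter Γ.ArtinGroup} (hEven : Γ.IsEven)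
    (hχ : χ ≠ 0) {K : Type*} [Field K] (ν : AddValuation K (WithTop ℝ)) (a : V → Kˣ) (b : V → K)
    (ha : ∀ u, ν (a u) = (weight χ u : WithTop ℝ))
    (hrel : ∀ (u v : V) (e : Γ.graph.edgeSet), e.1 = s(u, v) →
      (1 - (a v : K)) * b u = (1 - (a u : K)) * b v ∨
        a u * a v ≠ 1 ∧ ∃ k, Γ.label e = 2 * k ∧ (a u * a v) ^ k = 1)
    {t s : V} (ht : weight χ t ≠ 0) (hbt : b t = 0) (hbs : b s ≠ 0) :
    rayOfNeZero ℝ χ.metabelian (RealCharacter.metabelian_ne_zero hχ) ∉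
      sigmaOne (Γ.ArtinGroup ⧸ derivedSeries Γ.ArtinGroup 2) := by
  let ρ : Γ.ArtinGroup →* Equiv.Perm K :=
    PresentedGroup.toGroup (f := fun u => affinePerm (a u) (b u)) <|
      lift_eq_one_of_mem_artinRels fun u v e he => by
        obtain ⟨k, -, hk⟩ := hEven.exists_label_eq e
        rw [hk, altProd_two_mul, altProd_two_mul, affinePerm_mul, affinePerm_mul]
        -- Either the two affine maps commute, or both sides of the Artin relation are the identity.
        rcases hrel u v e he with h | ⟨h1, k', hk', h⟩
        · rw [mul_comm (a v)]
          congr 2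
          linear_combination h
        · obtain rfl : k' = k := by omega
          rw [affinePerm_pow_eq_one h1 h, mul_comm (a v), affinePerm_pow_eq_one h1 h]
  have hρof : ∀ u x, ρ (PresentedGroup.of u) x = a u * x + b u := fun u x => by
    simp only [ρ, PresentedGroup.toGroup.of, affinePerm_apply]
  let l : Γ.ArtinGroup →* Kˣ := PresentedGroup.toGroup (f := a) <|
    lift_eq_one_of_mem_artinRels fun u v e he => by
      obtain ⟨k, -, hk⟩ := hEven.exists_label_eq e
      rw [hk, altProd_two_mul, altProd_two_mul, mul_comm]
  have hlof : ∀ u, l (PresentedGroup.of u) = a u := fun u => PresentedGroup.toGroup.of _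
  have hρl : ∀ g x y, ρ g x - ρ g y = l g * (x - y) := by
    intro g
    induction g using ArtinGroup.induction with
    | of v =>
      intro x y
      rw [hρof, hρof, hlof]
      ring
    | one => simp
    | mul g h hg hh =>
      intro x y
      rw [map_mul, map_mul, Equiv.Perm.mul_apply, Equiv.Perm.mul_apply, hg, hh, Units.val_mul,
        mul_assoc]
    | inv g hg =>
      intro x y
      have hinv : ∀ x, ρ g (ρ g⁻¹ x) = x := fun x => by
        rw [← Equiv.Perm.mul_apply, ← map_mul, mul_inv_cancel, map_one, Equiv.Perm.one_apply]
      have := hg (ρ g⁻¹ x) (ρ g⁻¹ y)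
      rw [hinv, hinv] at this
      rw [map_inv l, this, Units.inv_mul_cancel_left]
  have hlν : ∀ g, ν (l g) = (χ (Additive.ofMul g) : WithTop ℝ) := by
    intro g
    induction g using ArtinGroup.induction with
    | of v => rw [hlof, ha]; rfl
    | one => simp
    | mul g h hg hh =>
      rw [map_mul, Units.val_mul, ν.map_mul, hg, hh, ofMul_mul, map_add, WithTop.coe_add]
    | inv g hg =>
      have h1 : ν (l g) + ν (l g⁻¹) = 0 := by
        rw [← ν.map_mul, ← Units.val_mul, ← map_mul, mul_inv_cancel, map_one, Units.val_one,
          ν.map_one]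
      rw [hg] at h1
      rw [ofMul_inv, map_neg]
      cases h : ν (l g⁻¹) with
      | top => rw [h] at h1; simp at h1
      | coe r =>
        rw [h] at h1
        norm_cast at h1 ⊢
        linarith
  rw [rayOfNeZero_mem_sigmaOne_iff]
  rintro ⟨X, hX, -, hc⟩
  let ρ' : Γ.ArtinGroup ⧸ derivedSeries Γ.ArtinGroup 2 →* Equiv.Perm K :=
    QuotientGroup.lift _ ρ (derivedSeries_two_le_ker_of_affine ρ l hρl)
  obtain ⟨g, hg, hg'⟩ := exists_not_halfSpaceJoined (χ := χ.metabelian) ν ρ' (fun q x y => by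
      obtain ⟨g, rfl⟩ := QuotientGroup.mk_surjective q
      rw [χ.metabelian_mk, ← hlν, ← ν.map_mul, ← hρl]
      rfl)
    (t := QuotientGroup.mk (PresentedGroup.of t)) (s := QuotientGroup.mk (PresentedGroup.of s))
    (show ρ (PresentedGroup.of t) 0 = 0 by rw [hρof, hbt, mul_zero, add_zero])
    (by rw [χ.metabelian_mk]; exact ht)
    (show ρ (PresentedGroup.of s) 0 ≠ 0 by rwa [hρof, mul_zero, zero_add]) hX
  exact hg' (hc g hg)

/-! ### Obstructions over Hahn series -/

/-- The monomial `z T ^ r` as a unit of the field of Hahn series. -/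
noncomputable def hahnMonomial (r : ℝ) (z : ℂˣ) : (HahnSeries ℝ ℂ)ˣ where
  val := HahnSeries.single r (z : ℂ)
  inv := HahnSeries.single (-r) ((z⁻¹ : ℂˣ) : ℂ)
  val_inv := by simp
  inv_val := by simp

theorem hahnMonomial_mul (r r' : ℝ) (z z' : ℂˣ) :
    hahnMonomial r z * hahnMonomial r' z' = hahnMonomial (r + r') (z * z') := by
  ext1
  simp [hahnMonomial]

theorem hahnMonomial_zero_one : hahnMonomial 0 1 = 1 :=
  Units.ext rfl

theorem hahnMonomial_zero_pow (z : ℂˣ) (k : ℕ) : hahnMonomial 0 z ^ k = hahnMonomial 0 (z ^ k) := by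
  induction k with
  | zero => simp [hahnMonomial_zero_one]
  | succ k ih => rw [pow_succ, ih, hahnMonomial_mul, pow_succ, add_zero]

theorem hahnMonomial_injective {r r' : ℝ} {z z' : ℂˣ} (h : hahnMonomial r z = hahnMonomial r' z') :
    r = r' ∧ z = z' := by
  have h1 : HahnSeries.single r (z : ℂ) = HahnSeries.single r' (z' : ℂ) := congrArg Units.val h
  have hr : r = r' := by
    have := congrArg HahnSeries.order h1
    rwa [HahnSeries.order_single z.ne_zero, HahnSeries.order_single z'.ne_zero] at this
  subst hr
  exact ⟨rfl, Units.ext (HahnSeries.single_injective r h1)⟩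

theorem addVal_hahnMonomial (r : ℝ) (z : ℂˣ) :
    HahnSeries.addVal ℝ ℂ (hahnMonomial r z) = (r : WithTop ℝ) :=
  HahnSeries.addVal_apply.trans (HahnSeries.orderTop_single z.ne_zero)

/-- Let `v₀` translate by `1` and every other `u` scale by `T ^ weight χ u`. The neighbours of `v₀`
have weight zero, so they act trivially and the relations hold. -/
theorem metabelian_notMem_sigmaOne_of_not_dominating {χ : RealCharacter Γ.ArtinGroup}
    (hEven : Γ.IsEven) (hχ : χ ≠ 0) {v₀ : V} (hv₀ : weight χ v₀ = 0)
    (h : ∀ u, weight χ u ≠ 0 → ¬ Γ.graph.Adj u v₀) :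
    rayOfNeZero ℝ χ.metabelian (RealCharacter.metabelian_ne_zero hχ) ∉
      sigmaOne (Γ.ArtinGroup ⧸ derivedSeries Γ.ArtinGroup 2) := by
  classical
  obtain ⟨t, ht⟩ := exists_weight_ne_zero hχ
  have htv : t ≠ v₀ := by rintro rfl; exact ht hv₀
  refine metabelian_notMem_sigmaOne_of_affine hEven hχ (HahnSeries.addVal ℝ ℂ)
    (fun u => hahnMonomial (weight χ u) 1) (Pi.single v₀ 1) (fun u => addVal_hahnMonomial _ _)
    (fun u v e he => Or.inl ?_) ht (Pi.single_eq_of_ne htv 1) (s := v₀) (by simp)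
  have key : ∀ u v, Γ.graph.Adj u v →
      (1 - (hahnMonomial (weight χ v) 1 : HahnSeries ℝ ℂ)) *
        (Pi.single v₀ 1 : V → HahnSeries ℝ ℂ) u = 0 := by
    intro u v huv
    by_cases hu : u = v₀
    · subst hu
      have : weight χ v = 0 := by_contra fun hv => h v hv huv.symm
      rw [this, hahnMonomial_zero_one, Units.val_one, sub_self, zero_mul]
    · rw [Pi.single_eq_of_ne hu, mul_zero]
  have huv : Γ.graph.Adj u v := Γ.graph.mem_edgeSet.1 (he ▸ e.2)
  rw [key u v huv, key v u huv.symm]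

theorem exists_root_of_unity_ne_one {k : ℕ} (hk : 2 ≤ k) : ∃ z : ℂˣ, z ≠ 1 ∧ z ^ k = 1 := by
  have h := Complex.isPrimitiveRoot_exp k (by omega)
  obtain ⟨z, hz⟩ := h.isUnit (by omega)
  refine ⟨z, ?_, Units.ext ?_⟩
  · rintro rfl
    exact h.ne_one (by omega) hz.symm
  · rw [Units.val_pow_eq_pow_val, hz, h.pow_eq_one, Units.val_one]

theorem metabelian_notMem_sigmaOne_of_not_reachable [Finite V] {χ : RealCharacter Γ.ArtinGroup}
    (hEven : Γ.IsEven) (hOdd : Γ.OddCycleCondition) (hχ : χ ≠ 0) {u₀ v₀ : V}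
    (hu₀ : weight χ u₀ ≠ 0) (hv₀ : weight χ v₀ ≠ 0) (h : ¬ (livingGraph χ).Reachable u₀ v₀) :
    rayOfNeZero ℝ χ.metabelian (RealCharacter.metabelian_ne_zero hχ) ∉
      sigmaOne (Γ.ArtinGroup ⧸ derivedSeries Γ.ArtinGroup 2) := by
  classical
  let A : V → Prop := fun w => weight χ w ≠ 0 ∧ (livingGraph χ).Reachable u₀ w
  let B : V → Prop := fun w => weight χ w ≠ 0 ∧ ¬ (livingGraph χ).Reachable u₀ w
  have hAB : ∀ w, A w → ¬ B w := fun w hA hB => hB.2 hA.2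
  have hdead : ∀ u v (e : Γ.graph.edgeSet), e.1 = s(u, v) → A u → B v →
      2 < Γ.label e ∧ weight χ u + weight χ v = 0 := by
    intro u v e he hu hv
    have h1 : ¬ (livingGraph χ).Adj u v := fun hadj => hv.2 (hu.2.trans hadj.reachable)
    have h2 : ¬ (Γ.label e = 2 ∨ weight χ u + weight χ v ≠ 0) :=
      fun h' => h1 ⟨hu.1, hv.1, e, he, h'⟩
    push Not at h2
    exact ⟨lt_of_le_of_ne (Γ.two_le_label e) (Ne.symm h2.1), h2.2⟩
  -- All edges between the component `A` of `u₀` and the other living vertices `B`; they are dead,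
  -- so their labels exceed `2` and their weights cancel.
  let F : SimpleGraph V :=
    { Adj := fun u v => Γ.graph.Adj u v ∧ (A u ∧ B v ∨ B u ∧ A v)
      symm := ⟨fun u v ⟨h1, h2⟩ => ⟨h1.symm, h2.symm.imp And.symm And.symm⟩⟩
      loopless := ⟨fun u h1 => Γ.graph.loopless.irrefl u h1.1⟩ }
  have hFle : F ≤ Γ.graph := fun u v huv => huv.1
  have hFlabel : ∀ (e : Sym2 V) (he : e ∈ Γ.graph.edgeSet), e ∈ F.edgeSet →
      2 < Γ.label ⟨e, he⟩ := by
    intro e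
    induction e using Sym2.ind with
    | _ u v =>
    rintro he ⟨-, ⟨hu, hv⟩ | ⟨hu, hv⟩⟩
    · exact (hdead u v _ rfl hu hv).1
    · exact (hdead v u _ Sym2.eq_swap hv hu).1
  -- `A` and `B` two-colour `F`, so a cycle would be even, against the odd cycle condition.
  have hF : F.IsAcyclic := by
    intro v c hc
    have hodd := hOdd v (c.mapLe hFle) ((SimpleGraph.Walk.isCycle_mapLe hFle).2 hc)
      (fun e he => hFlabel e _ (c.edges_subset_edgeSet (by simpa using he)))
    let col : F.Coloring Bool := SimpleGraph.Coloring.mk (fun u => decide (A u)) (by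
      rintro u v ⟨-, ⟨hu, hv⟩ | ⟨hu, hv⟩⟩
      · have : ¬ A v := fun h' => hAB v h' hv
        simp [hu, this]
      · have : ¬ A u := fun h' => hAB u h' hu
        simp [hv, this])
    have heven : Even c.length := (col.even_length_iff_congr c).2 Iff.rfl
    rw [SimpleGraph.Walk.length_mapLe] at hodd
    exact Nat.not_even_iff_odd.2 hodd heven
  have hroot : ∀ e : Sym2 V, ∃ z : ℂˣ, ∀ he : e ∈ Γ.graph.edgeSet, 2 < Γ.label ⟨e, he⟩ →
      z ≠ 1 ∧ ∃ k, Γ.label ⟨e, he⟩ = 2 * k ∧ z ^ k = 1 := by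
    intro e
    by_cases H : ∃ he : e ∈ Γ.graph.edgeSet, 2 < Γ.label ⟨e, he⟩
    · obtain ⟨he, hl⟩ := H
      obtain ⟨k, -, hk⟩ := hEven.exists_label_eq ⟨e, he⟩
      obtain ⟨z, hz1, hz⟩ := exists_root_of_unity_ne_one (k := k) (by omega)
      exact ⟨z, fun _ _ => ⟨hz1, k, hk, hz⟩⟩
    · exact ⟨1, fun he hl => absurd ⟨he, hl⟩ H⟩
  choose ζ hζ using hroot
  -- `ζ` lives on unoriented edges; orienting them from `A` to `B` gives the required antisymmetry.
  obtain ⟨w, hw⟩ := hF.exists_potential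
    (fun u v => if A u ∧ B v then ζ s(u, v) else if B u ∧ A v then (ζ s(u, v))⁻¹ else 1) (by
      intro u v
      have e : s(v, u) = s(u, v) := Sym2.eq_swap
      by_cases h1 : A u ∧ B v
      · have h2 : ¬ (A v ∧ B u) := fun h' => hAB v h'.1 h1.2
        simp [h1, h2, e]
      · by_cases h2 : A v ∧ B u
        · simp [h1, h2, e]
        · have h1' : ¬ (B v ∧ A u) := fun h' => h1 h'.symm
          have h2' : ¬ (B u ∧ A v) := fun h' => h2 h'.symm
          simp [h1, h2, h1', h2'])
  -- Inverting `w` on `B` turns the quotient `w u / w v = ζ` into the product `z u * z v = ζ`.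
  let z : V → ℂˣ := fun u => if A u then w u else if B u then (w u)⁻¹ else 1
  let a : V → (HahnSeries ℝ ℂ)ˣ := fun u => hahnMonomial (weight χ u) (z u)
  have ha1 : ∀ u, weight χ u = 0 → a u = 1 := by
    intro u hu
    have hA : ¬ A u := fun h' => h'.1 hu
    have hB : ¬ B u := fun h' => h'.1 hu
    simp only [a, z, hA, hB, if_false, hu]
    exact hahnMonomial_zero_one
  have hab : ∀ u v (e : Γ.graph.edgeSet), e.1 = s(u, v) → A u → B v →
      a u * a v ≠ 1 ∧ ∃ k, Γ.label e = 2 * k ∧ (a u * a v) ^ k = 1 := by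
    rintro u v ⟨e, he'⟩ he hu hv
    obtain rfl : e = s(u, v) := he
    obtain ⟨hl, hsum⟩ := hdead u v ⟨_, he'⟩ rfl hu hv
    obtain ⟨hne, k, hk, hpow⟩ := hζ _ he' hl
    have hwuv := hw u v ⟨he', Or.inl ⟨hu, hv⟩⟩
    rw [if_pos ⟨hu, hv⟩] at hwuv
    have hA : ¬ A v := fun h' => hAB v h' hv
    have : a u * a v = hahnMonomial 0 (ζ s(u, v)) := by
      simp only [a, z, hahnMonomial_mul, hsum, if_pos hu, if_neg hA, if_pos hv, hwuv,
        mul_inv_cancel_right]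
    rw [this]
    refine ⟨fun h' => hne (hahnMonomial_injective (h'.trans hahnMonomial_zero_one.symm)).2, k, hk, ?_⟩
    rw [hahnMonomial_zero_pow, hpow, hahnMonomial_zero_one]
  have hAu₀ : A u₀ := ⟨hu₀, SimpleGraph.Reachable.refl _⟩
  -- The translation part `1 - a u` makes the vertices of `B` fix `1`, while those of `A` fix `0`
  -- and those of weight zero act trivially.
  refine metabelian_notMem_sigmaOne_of_affine hEven hχ (HahnSeries.addVal ℝ ℂ) a
    (fun u => if B u then 1 - (a u : HahnSeries ℝ ℂ) else 0) (fun u => addVal_hahnMonomial _ _)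
    (fun u v e he => ?_) hu₀ (if_neg (hAB u₀ hAu₀)) (s := v₀) ?_
  · have hcases : ∀ u, weight χ u = 0 ∨ A u ∨ B u := fun u => by
      by_cases h1 : weight χ u = 0
      · exact Or.inl h1
      · by_cases h2 : (livingGraph χ).Reachable u₀ u
        · exact Or.inr (Or.inl ⟨h1, h2⟩)
        · exact Or.inr (Or.inr ⟨h1, h2⟩)
    have hB0 : ∀ u, weight χ u = 0 → ¬ B u := fun u hu h' => h'.1 hu
    rcases hcases u with hu | hu | hu
    · left; simp [hB0 u hu, ha1 u hu]
    · rcases hcases v with hv | hv | hv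
      · left; simp [hB0 v hv, ha1 v hv]
      · left; simp [hAB u hu, hAB v hv]
      · exact Or.inr (hab u v e he hu hv)
    · rcases hcases v with hv | hv | hv
      · left; simp [hB0 v hv, ha1 v hv]
      · right
        rw [mul_comm (a u)]
        exact hab v u e (he.trans Sym2.eq_swap) hv hu
      · left
        simp only [if_pos hu, if_pos hv]
        ring
  · have hBv₀ : B v₀ := ⟨hv₀, h⟩
    simp only [if_pos hBv₀]
    rw [sub_ne_zero]
    intro h'
    exact hv₀ (hahnMonomial_injective ((Units.ext h').symm.trans hahnMonomial_zero_one.symm)).1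

end LabelledGraph

theorem corollaryC {V : Type*} [Finite V] (Γ : LabelledGraph V) (hEven : Γ.IsEven)
    (hOdd : Γ.OddCycleCondition) (χ : RealCharacter Γ.ArtinGroup) (hχ : χ ≠ 0) :
    rayOfNeZero ℝ χ hχ ∈ sigmaOne Γ.ArtinGroup ↔
      rayOfNeZero ℝ χ.metabelian (RealCharacter.metabelian_ne_zero hχ) ∈
        sigmaOne (Γ.ArtinGroup ⧸ derivedSeries Γ.ArtinGroup 2) := by
  refine ⟨mem_sigmaOne_metabelian hχ, fun h => ?_⟩
  refine LabelledGraph.mem_sigmaOne_of_livingGraph hEven hχ (fun u v hu hv => ?_) fun v hv => ?_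
  · by_contra H
    exact LabelledGraph.metabelian_notMem_sigmaOne_of_not_reachable hEven hOdd hχ hu hv H h
  · by_contra! H
    exact LabelledGraph.metabelian_notMem_sigmaOne_of_not_dominating hEven hχ hv H h
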